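/- **Setting.** Consider $n$ nodes in an asynchronous network (messages are delayed arbitrarily by an adversary but are eventually delivered). An adaptive adversary corrupts at most $t$ nodes; let $\mathcal F$, $|\mathcal F|\le t$, be the set of all nodes that are ever corrupted (dishonest nodes); the others are honest. The following are given. - An $(n,t+1)$ erasure code over an alphabet $\Sigma$: maps $\mathrm{Enc}:\Sigma^{t+1}\to\Sigma^n$ and $\mathrm{Dec}$ such that every message $w\in\Sigma^{t+1}$ is recovered by $\mathrm{Dec}$ from the symbols of $\mathrm{Enc}(w)$ at any $t+1$ positions. - For each $j\in[1:n]$, a reliable broadcast protocol $\mathrm{RBC}_j$ for symbols in $\Sigma$ with leader Node $j$. *Consistency:* any two outputs of honest nodes are equal. *Validity:* if the leader is honest and inputs $v$, every honest node eventually outputs $v$. *Totality:* if one honest node outputs a value, every honest node eventually outputs a value. - For each $j\in[1:n]$, a binary Byzantine agreement protocol $\mathrm{ABBA}_j$. *Termination:* if all honest nodes input a bit, every honest node eventually outputs a bit. *Consistency:* if an honest node outputs $b$, every honest node eventually outputs $b$. *Validity:* if all honest nodes input the same $b$, every honest node eventually outputs $b$. RBC Consistency holds in every run. The other five properties (RBC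 Validity and Totality, and all three ABBA properties) are required only of runs in which no honest node abandons the instance before obtaining an output from it. **Protocol OciorABA\*.** Each honest Node $i$ runs the following code. After each event (receiving its input, or the delivery of an output by an instance), all rules whose conditions hold are executed at once, in the order listed. A node passes at most one input into each instance. 1. On receiving its input $w_i\in\Sigma^{t+1}$, compute $(y^{(i)}_1,\dots,y^{(i)}_n)=\mathrm{Enc}(w_i)$ and pass $y^{(i)}_i$ into $\mathrm{RBC}_i$. 2. When $\mathrm{RBC}_j$ has delivered a symbol $y_j$ and the symbols $y^{(i)}_1,\dots,y^{(i)}_n$ have been computed: if Node $i$ has not yet passed an input into $\mathrm{ABBA}_j$, pass in $1$ if $y_j=y_j^{(i)}$, and $0$ otherwise. 3. When at least $n-t$ of the ABBA instances have delivered outputs, pass $0$ into every ABBA instance that has not yet received an input from Node $i$. 4. When all $n$ ABBA instances have delivered outputs, let $\mathcal A$ be the set of indices $j$ for which $\mathrm{ABBA}_j$ delivered $1$. If $|\mathcal A|<t+1$, output the default value $\bot$ and terminate. Otherwise wait until $\mathrm{RBC}_j$ has delivered $y_j$ for all $j$ in the set $\mathcal A_{t+1}$ of the $t+1$ smallest elements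 of $\mathcal A$, then output $\mathrm{Dec}(\{y_j\}_{j\in\mathcal A_{t+1}})$ and terminate. A node that terminates stops executing this code, and thereby abandons every instance from which it has not yet obtained an output. **Theorem (Termination).** Let $n\ge 3t+1$. In every execution of OciorABA\* in which every honest node receives an input: (a) all $n$ ABBA instances eventually deliver outputs at every honest node; (b) every honest node eventually outputs a value (a message in $\Sigma^{t+1}$ or the default value $\bot$) and terminates. -/

import Mathlib

namespace AsyncBA

/-! ### Primitive protocols, seen at their interface

Nodes are indexed by `Fin n`.  A primitive protocol (reliable broadcast, binary agreement) is
used by the code of a node only through its interface: the node passes an input into an instance,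
and the instance delivers an output.  A protocol is identified with the runs that it admits, one
set of runs for every set `F` of dishonest nodes.  The asynchronous network, the adversary and the
common coin all act inside these runs. -/

/-- The interface of one node with one instance of a primitive at one moment. -/
structure Port (I O : Type*) where
  /-- the input passed into the instance so far, if any -/
  inp : Option I
  /-- the output delivered by the instance so far, if any -/
  out : Option O
  /-- the node has stopped executing the code that called the instance -/
  stopped : Bool

/-- The port of a node that does nothing; it also stands at the positions of dishonest nodes,
which have no prescribed interface. -/
def Port.blank {I O : Type*} : Port I O := ⟨none, none, false⟩

/-- The history of all ports of one instance, over discrete time. -/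
abbrev Run (n : ℕ) (I O : Type*) := ℕ → Fin n → Port I O

/-- A primitive protocol among `n` nodes: for each set of dishonest nodes (all nodes that the
adversary ever corrupts), the runs that are possible. -/
abbrev Primitive (n : ℕ) (I O : Type*) := Finset (Fin n) → Set (Run n I O)

section Specifications

variable {n : ℕ} {I O : Type*}

/-- Node `i` eventually (at some time) has passed the input `v` into the instance. -/
def Run.Inputs (τ : Run n I O) (i : Fin n) (v : I) : Prop := ∃ k, (τ k i).inp = some v

/-- Node `i` eventually (at some time) outputs `v` from the instance. -/
def Run.Outputs (τ : Run n I O) (i : Fin n) (v : O) : Prop := ∃ k, (τ k i).out = some v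

/-- No honest node leaves the instance before the instance has delivered an output to it.
What an honest node does inside the instance after its output (for example, to help other nodes)
is the business of the primitive. -/
def Run.FullParticipation (F : Finset (Fin n)) (τ : Run n I O) : Prop :=
  ∀ i ∉ F, ∀ k, (τ k i).stopped = true → (τ k i).out.isSome = true

/-- Byzantine agreement on values in `V`, against at most `t` dishonest nodes. The properties are
required only if the honest nodes take part until they have an output. -/
structure IsByzantineAgreement {V : Type*} (t : ℕ) (P : Primitive n V V) : Prop where
  /-- If all honest nodes receive their inputs, then every honest node eventually outputs. -/
  termination : ∀ F : Finset (Fin n), F.card ≤ t → ∀ τ ∈ P F, τ.FullParticipation F →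
    (∀ i ∉ F, ∃ v, τ.Inputs i v) → ∀ i ∉ F, ∃ v, τ.Outputs i v
  /-- If any honest node outputs `v`, then every honest node eventually outputs `v`. -/
  consistency : ∀ F : Finset (Fin n), F.card ≤ t → ∀ τ ∈ P F, τ.FullParticipation F →
    ∀ v, (∃ i ∉ F, τ.Outputs i v) → ∀ i ∉ F, τ.Outputs i v
  /-- If all honest nodes input the same `v`, then every honest node eventually outputs `v`. -/
  validity : ∀ F : Finset (Fin n), F.card ≤ t → ∀ τ ∈ P F, τ.FullParticipation F →
    ∀ v, (∀ i ∉ F, τ.Inputs i v) → ∀ i ∉ F, τ.Outputs i v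

/-- Reliable broadcast of a value in `V` by the node `leader`, against at most `t` dishonest
nodes. The eventual properties are required only if the honest nodes take part until they have an
output. -/
structure IsReliableBroadcast {V : Type*} (t : ℕ) (leader : Fin n) (P : Primitive n V V) :
    Prop where
  /-- Outputs of honest nodes are equal. -/
  consistency : ∀ F : Finset (Fin n), F.card ≤ t → ∀ τ ∈ P F,
    ∀ i ∉ F, ∀ i' ∉ F, ∀ v v', τ.Outputs i v → τ.Outputs i' v' → v = v'
  /-- If the leader is honest and inputs `v`, then every honest node eventually outputs `v`. -/
  validity : ∀ F : Finset (Fin n), F.card ≤ t → ∀ τ ∈ P F, τ.FullParticipation F →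
    leader ∉ F → ∀ v, τ.Inputs leader v → ∀ i ∉ F, τ.Outputs i v
  /-- If one honest node outputs a value, then every honest node eventually outputs a value. -/
  totality : ∀ F : Finset (Fin n), F.card ≤ t → ∀ τ ∈ P F, τ.FullParticipation F →
    (∃ i ∉ F, ∃ v, τ.Outputs i v) → ∀ i ∉ F, ∃ v, τ.Outputs i v

end Specifications

/-- An `(n, k)` erasure code over the alphabet `A`: a message of `k` symbols is encoded into `n`
symbols and can be decoded from the symbols at any `k` positions. -/
structure ErasureCode (n k : ℕ) (A : Type*) where
  enc : (Fin k → A) → Fin n → A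
  dec : (S : Finset (Fin n)) → (S → A) → Fin k → A
  dec_enc : ∀ (S : Finset (Fin n)), S.card = k → ∀ w : Fin k → A, dec S (fun j => enc w j) = w

/-! ### The code of one node -/

/-- A message: `t + 1` symbols of the alphabet. -/
abbrev Message (t : ℕ) (A : Type*) := Fin (t + 1) → A

/-- The possible final outputs: the default value, or a message. -/
inductive FinalOutput (t : ℕ) (A : Type*) where
  | default
  | message (w : Message t A)

/-- What can happen to a node: it receives its input, or an instance of one of the two primitives
delivers an output to it. (The code of a node sends no messages outside the primitives.) -/
inductive Event (n t : ℕ) (A : Type*) where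
  | input (w : Message t A)
  | rbcDeliver (j : Fin n) (y : A)
  | abbaDeliver (j : Fin n) (b : Bool)

/-- The local state of a node. -/
structure NodeState (n t : ℕ) (A : Type*) where
  /-- the input message, once received -/
  input : Option (Message t A)
  /-- the symbol passed into the broadcast instance which this node leads -/
  rbcIn : Option A
  /-- the symbol delivered by the `j`th broadcast instance -/
  rbcOut : Fin n → Option A
  /-- the bit passed into the `j`th binary agreement instance -/
  abbaIn : Fin n → Option Bool
  /-- the bit delivered by the `j`th binary agreement instance -/
  abbaOut : Fin n → Option Bool
  /-- the final output -/
  output : Option (FinalOutput t A)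
  terminated : Bool

/-- The state of a node at the beginning. -/
def NodeState.initial (n t : ℕ) (A : Type*) : NodeState n t A where
  input := none
  rbcIn := none
  rbcOut := fun _ => none
  abbaIn := fun _ => none
  abbaOut := fun _ => none
  output := none
  terminated := false

/-- The `m` smallest elements of `S` (all elements, if `S` has fewer than `m`). -/
def firstSmallest {n : ℕ} (m : ℕ) (S : Finset (Fin n)) : Finset (Fin n) :=
  S.filter fun j => (S.filter fun i => i < j).card < m

section Code

variable {n t : ℕ} {A : Type*}

/-- Record an event at node `i`. On receiving the input, the node encodes it and passes its own
symbol, number `i`, into the broadcast instance that it leads. An instance delivers at most one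
output to a node, so only a first delivery is recorded. -/
def NodeState.receive (C : ErasureCode n (t + 1) A) (i : Fin n) (s : NodeState n t A) :
    Event n t A → NodeState n t A
  | .input w =>
      match s.input with
      | none => { s with input := some w, rbcIn := some (C.enc w i) }
      | some _ => s
  | .rbcDeliver j y => { s with rbcOut := Function.update s.rbcOut j (some ((s.rbcOut j).getD y)) }
  | .abbaDeliver j b =>
      { s with abbaOut := Function.update s.abbaOut j (some ((s.abbaOut j).getD b)) }

open Classical in
/-- Whenever the `j`th broadcast has delivered a symbol and the own symbols have been computed, pass
`1` into the `j`th agreement instance if the delivered symbol is the own symbol number `j`, and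
`0` otherwise; an instance that already has an input from this node is left alone. -/
noncomputable def NodeState.compareSymbols (C : ErasureCode n (t + 1) A) (s : NodeState n t A) :
    NodeState n t A :=
  { s with
    abbaIn := fun j =>
      match s.abbaIn j, s.input, s.rbcOut j with
      | none, some w, some y => some (decide (y = C.enc w j))
      | b, _, _ => b }

/-- When `n - t` agreement instances have delivered, pass `0` into each agreement instance that has
no input from this node yet. -/
def NodeState.fillZeros (s : NodeState n t A) : NodeState n t A :=
  if n - t ≤ (Finset.univ.filter fun j => (s.abbaOut j).isSome = true).card then
    { s with abbaIn := fun j => some ((s.abbaIn j).getD false) }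
  else s

/-- The indices of the agreement instances that have delivered `1`. -/
def NodeState.ones (s : NodeState n t A) : Finset (Fin n) :=
  Finset.univ.filter fun j => s.abbaOut j = some true

/-- When all agreement instances have delivered: if fewer than `t + 1` of them delivered `1`, output
the default value and terminate; otherwise wait for the symbols of the first `t + 1` broadcast
instances whose agreement instance delivered `1`, decode, output and terminate. -/
def NodeState.finish (C : ErasureCode n (t + 1) A) (s : NodeState n t A) : NodeState n t A :=
  if ∀ j, (s.abbaOut j).isSome = true then
    if s.ones.card < t + 1 then
      { s with output := some .default, terminated := true }
    else if h : ∀ j ∈ firstSmallest (t + 1) s.ones, (s.rbcOut j).isSome = true then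
      { s with
        output := some (.message
          (C.dec (firstSmallest (t + 1) s.ones) fun j => (s.rbcOut j).get (h j j.2)))
        terminated := true }
    else s
  else s

/-- The reaction of an honest node to an event. A terminated node does not react any more. -/
noncomputable def NodeState.react (C : ErasureCode n (t + 1) A) (i : Fin n) (s : NodeState n t A)
    (e : Event n t A) : NodeState n t A :=
  if s.terminated = true then s
  else (((s.receive C i e).compareSymbols C).fillZeros).finish C

end Code

/-! ### Executions -/

/-- The local states over time, under a sequence of events, each at one node (`none` stands for a
moment at which nothing happens at the interface of the primitives). -/
noncomputable def stateAt {n t : ℕ} {A : Type*} (C : ErasureCode n (t + 1) A)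
    (event : ℕ → Option (Fin n × Event n t A)) : ℕ → Fin n → NodeState n t A
  | 0, _ => NodeState.initial n t A
  | k + 1, i =>
      match event k with
      | none => stateAt C event k i
      | some (i', e) =>
          if i = i' then (stateAt C event k i).react C i e else stateAt C event k i

/-- The run of the broadcast instance led by node `j` in an execution. -/
def rbcRun {n t : ℕ} {A : Type*} (F : Finset (Fin n)) (σ : ℕ → Fin n → NodeState n t A)
    (j : Fin n) : Run n A A := fun k i =>
  if i ∈ F then Port.blank
  else ⟨if i = j then (σ k i).rbcIn else none, (σ k i).rbcOut j, (σ k i).terminated⟩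

/-- The run of the `j`th binary agreement instance in an execution. -/
def abbaRun {n t : ℕ} {A : Type*} (F : Finset (Fin n)) (σ : ℕ → Fin n → NodeState n t A)
    (j : Fin n) : Run n Bool Bool := fun k i =>
  if i ∈ F then Port.blank
  else ⟨(σ k i).abbaIn j, (σ k i).abbaOut j, (σ k i).terminated⟩

/-- An execution of OciorABA* among `n` nodes, at most `t` of them dishonest, which uses the erasure
code `C`, the protocol `rbc j` as broadcast instance with leader `j`, and the protocol `abba j` as
`j`th binary agreement instance: the honest nodes run the code above (the states at the positions
of dishonest nodes have no meaning and are never used), and every instance behaves as its protocol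
allows. -/
structure Execution {n t : ℕ} {A : Type*} (C : ErasureCode n (t + 1) A)
    (rbc : Fin n → Primitive n A A) (abba : Fin n → Primitive n Bool Bool) where
  /-- the dishonest nodes: all nodes that are corrupted at some time -/
  faulty : Finset (Fin n)
  faulty_card_le : faulty.card ≤ t
  event : ℕ → Option (Fin n × Event n t A)
  rbc_mem : ∀ j, rbcRun faulty (stateAt C event) j ∈ rbc j faulty
  abba_mem : ∀ j, abbaRun faulty (stateAt C event) j ∈ abba j faulty

/-- The state of node `i` after `k` steps of the execution. -/
noncomputable def Execution.state {n t : ℕ} {A : Type*} {C : ErasureCode n (t + 1) A}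
    {rbc : Fin n → Primitive n A A} {abba : Fin n → Primitive n Bool Bool}
    (E : Execution C rbc abba) (k : ℕ) (i : Fin n) : NodeState n t A :=
  stateAt C E.event k i

end AsyncBA

namespace AsyncBA

/-! ### Invariants of a single node, rule by rule. -/

section Code

variable {n t : ℕ} {A : Type*} (C : ErasureCode n (t + 1) A)

/-! The difficulty is that a terminating node abandons instances, while most guarantees of the
primitives assume full participation. Agreement instances are never abandoned early, since
termination requires all their outputs. Broadcast instances can be, so their guarantees must be
earned.

For (a), split on whether some honest node ever terminates. If so, it holds all `n` agreement
outputs, and consistency spreads them (`abbaOut_spread`). If not, participation in the broadcasts is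
trivially full: validity for honest leaders makes every honest node feed the at least `n - t`
agreement instances with honest index, these deliver, and the zero-filling rule feeds the rest
(`abbaOut_of_forall_not_terminated`).

For (b), all honest nodes end with the same set of ones, hence wait for the same `t + 1` broadcasts.
No honest node terminates before these deliver to it, so exactly for them participation is full.
Each has an honest input `1` behind it (`exists_abbaIn_true`), which comes from a delivered symbol,
and totality brings a symbol to everyone.

The local facts are collected in the invariant `NodeState.Settled`. -/

/-- All agreement instances have delivered, and if at least `t + 1` of them delivered `1`, then so
have the first `t + 1` of the corresponding broadcast instances. -/
def NodeState.Ready (s : NodeState n t A) : Prop :=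
  (∀ j, (s.abbaOut j).isSome = true) ∧
    (t + 1 ≤ s.ones.card → ∀ j ∈ firstSmallest (t + 1) s.ones, (s.rbcOut j).isSome = true)

/-- The properties that hold of the state of a node between any two events. -/
structure NodeState.Settled (s : NodeState n t A) : Prop where
  rbcIn_isSome : s.input.isSome = true → s.rbcIn.isSome = true
  rbcOut_isSome : ∀ j, s.abbaIn j = some true → (s.rbcOut j).isSome = true
  compared : s.input.isSome = true → ∀ j, (s.rbcOut j).isSome = true →
    (s.abbaIn j).isSome = true
  filled : n - t ≤ (Finset.univ.filter fun j => (s.abbaOut j).isSome = true).card →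
    ∀ j, (s.abbaIn j).isSome = true
  terminated_iff : s.terminated = true ↔ s.Ready
  output_isSome : s.terminated = true → s.output.isSome = true

/-- Here `t < n` matters twice: the filling threshold `n - t` is positive, and some instance exists
that has not delivered, so the state is not `Ready`. -/
theorem NodeState.settled_initial (htn : t < n) :
    (NodeState.initial n t A).Settled := by
  have : 0 < n := by omega
  refine ⟨by simp [initial], by simp [initial], by simp [initial], ?_, ?_, by simp [initial]⟩
  · intro h
    simp [initial] at h
    omega
  · simp only [initial, Ready, Bool.false_eq_true, false_iff]
    intro h
    simpa using h.1 ⟨0, this⟩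

section finish

variable (s : NodeState n t A)

theorem NodeState.finish_input : (s.finish C).input = s.input := by
  unfold finish; split_ifs <;> rfl

theorem NodeState.finish_rbcIn : (s.finish C).rbcIn = s.rbcIn := by
  unfold finish; split_ifs <;> rfl

theorem NodeState.finish_rbcOut : (s.finish C).rbcOut = s.rbcOut := by
  unfold finish; split_ifs <;> rfl

theorem NodeState.finish_abbaIn : (s.finish C).abbaIn = s.abbaIn := by
  unfold finish; split_ifs <;> rfl

theorem NodeState.finish_abbaOut : (s.finish C).abbaOut = s.abbaOut := by
  unfold finish; split_ifs <;> rfl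

theorem NodeState.finish_ready : (s.finish C).Ready ↔ s.Ready := by
  simp only [Ready, ones, finish_abbaOut, finish_rbcOut]

theorem NodeState.finish_terminated_iff (hs : s.terminated = false) :
    (s.finish C).terminated = true ↔ s.Ready := by
  unfold finish Ready
  split_ifs with h1 h2 h3
  · simpa [h1] using fun h => absurd h (by omega)
  · simpa [h1] using fun _ => h3
  · simp only [hs, Bool.false_eq_true, false_iff]
    exact fun h => h3 (h.2 (by omega))
  · simp only [hs, Bool.false_eq_true, false_iff]
    exact fun h => h1 h.1

theorem NodeState.finish_output_isSome (hs : s.terminated = false)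
    (h : (s.finish C).terminated = true) : (s.finish C).output.isSome = true := by
  revert h
  unfold finish
  split_ifs <;> simp [hs]

end finish

section fillZeros

variable (s : NodeState n t A)

theorem NodeState.fillZeros_eq : s.fillZeros = { s with abbaIn := s.fillZeros.abbaIn } := by
  unfold fillZeros; split_ifs <;> rfl

/-- Filling only adds zeros, so every input `1` stems from a comparison with a delivered symbol. -/
theorem NodeState.fillZeros_abbaIn_eq_true {j : Fin n} :
    s.fillZeros.abbaIn j = some true ↔ s.abbaIn j = some true := by
  unfold fillZeros
  split_ifs
  · cases h : s.abbaIn j <;> simp [h]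
  · rfl

theorem NodeState.fillZeros_abbaIn_isSome {j : Fin n} (h : (s.abbaIn j).isSome = true) :
    (s.fillZeros.abbaIn j).isSome = true := by
  unfold fillZeros
  split_ifs
  · simp
  · exact h

theorem NodeState.fillZeros_filled
    (h : n - t ≤ (Finset.univ.filter fun j => (s.abbaOut j).isSome = true).card) (j : Fin n) :
    (s.fillZeros.abbaIn j).isSome = true := by
  simp [fillZeros, h]

end fillZeros

section compareSymbols

variable (s : NodeState n t A)

theorem NodeState.compareSymbols_abbaIn_isSome (hi : s.input.isSome = true) {j : Fin n}
    (hj : (s.rbcOut j).isSome = true) : ((s.compareSymbols C).abbaIn j).isSome = true := by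
  obtain ⟨w, hw⟩ := Option.isSome_iff_exists.1 hi
  obtain ⟨y, hy⟩ := Option.isSome_iff_exists.1 hj
  cases h : s.abbaIn j <;> simp [compareSymbols, h, hw, hy]

/-- A fresh bit is produced only in the branch where a symbol is present; older bits are covered by
`hs`. -/
theorem NodeState.compareSymbols_rbcOut_isSome
    (hs : ∀ j, s.abbaIn j = some true → (s.rbcOut j).isSome = true) {j : Fin n}
    (h : (s.compareSymbols C).abbaIn j = some true) : (s.rbcOut j).isSome = true := by
  cases ha : s.abbaIn j with
  | some b =>
    simp only [compareSymbols, ha] at h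
    exact hs j (ha.trans h)
  | none =>
    cases hr : s.rbcOut j with
    | some y => rfl
    | none => cases hi : s.input <;> simp [compareSymbols, ha, hr, hi] at h

end compareSymbols

/-! ### Recording an event: outputs and inputs persist. -/

section receive

variable (i : Fin n) (s : NodeState n t A) (e : Event n t A)

theorem NodeState.receive_abbaIn : (s.receive C i e).abbaIn = s.abbaIn := by
  cases e <;> simp only [receive]
  split <;> rfl

theorem NodeState.receive_terminated : (s.receive C i e).terminated = s.terminated := by
  cases e <;> simp only [receive]
  split <;> rfl

theorem NodeState.receive_abbaOut {j : Fin n} {b : Bool} (h : s.abbaOut j = some b) :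
    (s.receive C i e).abbaOut j = some b := by
  cases e with
  | input w => simp only [receive]; split <;> exact h
  | rbcDeliver j' y => exact h
  | abbaDeliver j' b' =>
    by_cases hj : j = j'
    · subst hj; simp [receive, h]
    · simp [receive, hj, h]

theorem NodeState.receive_rbcOut {j : Fin n} {y : A} (h : s.rbcOut j = some y) :
    (s.receive C i e).rbcOut j = some y := by
  cases e with
  | input w => simp only [receive]; split <;> exact h
  | abbaDeliver j' y => exact h
  | rbcDeliver j' b' =>
    by_cases hj : j = j'
    · subst hj; simp [receive, h]
    · simp [receive, hj, h]

theorem NodeState.receive_input {w : Message t A} (h : s.input = some w) :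
    (s.receive C i e).input = some w := by
  cases e <;> simp [receive, h]

theorem NodeState.receive_rbcIn_isSome
    (hs : s.input.isSome = true → s.rbcIn.isSome = true)
    (h : (s.receive C i e).input.isSome = true) : (s.receive C i e).rbcIn.isSome = true := by
  cases e with
  | input w =>
    cases hi : s.input with
    | none => simp [receive, hi]
    | some w' => simpa [receive, hi] using hs
  | rbcDeliver j y => exact hs h
  | abbaDeliver j b => exact hs h

end receive

section react

variable (i : Fin n) {s : NodeState n t A} (e : Event n t A)

theorem NodeState.react_of_terminated (h : s.terminated = true) : s.react C i e = s := by
  simp [react, h]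

theorem NodeState.react_input_eq (h : s.terminated = false) :
    (s.react C i e).input = (s.receive C i e).input := by
  simp only [react, h, Bool.false_eq_true, if_false, finish_input]
  rw [fillZeros_eq]; rfl

theorem NodeState.react_rbcIn_eq (h : s.terminated = false) :
    (s.react C i e).rbcIn = (s.receive C i e).rbcIn := by
  simp only [react, h, Bool.false_eq_true, if_false, finish_rbcIn]
  rw [fillZeros_eq]; rfl

theorem NodeState.react_rbcOut_eq (h : s.terminated = false) :
    (s.react C i e).rbcOut = (s.receive C i e).rbcOut := by
  simp only [react, h, Bool.false_eq_true, if_false, finish_rbcOut]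
  rw [fillZeros_eq]; rfl

theorem NodeState.react_abbaOut_eq (h : s.terminated = false) :
    (s.react C i e).abbaOut = (s.receive C i e).abbaOut := by
  simp only [react, h, Bool.false_eq_true, if_false, finish_abbaOut]
  rw [fillZeros_eq]; rfl

theorem NodeState.react_abbaIn_eq (h : s.terminated = false) :
    (s.react C i e).abbaIn = (((s.receive C i e).compareSymbols C).fillZeros).abbaIn := by
  simp only [react, h, Bool.false_eq_true, if_false, finish_abbaIn]

theorem NodeState.react_abbaOut {j : Fin n} {b : Bool} (h : s.abbaOut j = some b) :
    (s.react C i e).abbaOut j = some b := by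
  cases ht : s.terminated with
  | true => rwa [react_of_terminated C i e ht]
  | false => rw [react_abbaOut_eq C i e ht]; exact receive_abbaOut C i s e h

theorem NodeState.react_rbcOut {j : Fin n} {y : A} (h : s.rbcOut j = some y) :
    (s.react C i e).rbcOut j = some y := by
  cases ht : s.terminated with
  | true => rwa [react_of_terminated C i e ht]
  | false => rw [react_rbcOut_eq C i e ht]; exact receive_rbcOut C i s e h

theorem NodeState.react_input {w : Message t A} (h : s.input = some w) :
    (s.react C i e).input = some w := by
  cases ht : s.terminated with
  | true => rwa [react_of_terminated C i e ht]
  | false => rw [react_input_eq C i e ht]; exact receive_input C i s e h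

/-- A terminated state is frozen. Otherwise each rule leaves intact what the earlier ones
established, and `finish` runs last, on the delivered outputs of the current event, so termination
coincides with `Ready`. -/
theorem NodeState.Settled.react (hs : s.Settled) : (s.react C i e).Settled := by
  cases ht : s.terminated with
  | true => rwa [react_of_terminated C i e ht]
  | false =>
    have hfin : s.react C i e =
        (((s.receive C i e).compareSymbols C).fillZeros).finish C := by
      simp [NodeState.react, ht]
    have hterm : (((s.receive C i e).compareSymbols C).fillZeros).terminated = false := by
      rw [fillZeros_eq]
      exact (receive_terminated C i s e).trans ht
    refine ⟨?_, ?_, ?_, ?_, ?_, ?_⟩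
    · rw [react_input_eq C i e ht, react_rbcIn_eq C i e ht]
      exact receive_rbcIn_isSome C i s e hs.rbcIn_isSome
    · intro j
      rw [react_abbaIn_eq C i e ht, react_rbcOut_eq C i e ht, fillZeros_abbaIn_eq_true]
      refine compareSymbols_rbcOut_isSome C _ fun j hj => ?_
      rw [receive_abbaIn] at hj
      obtain ⟨y, hy⟩ := Option.isSome_iff_exists.1 (hs.rbcOut_isSome j hj)
      simp [receive_rbcOut C i s e hy]
    · intro hi j hj
      rw [react_input_eq C i e ht] at hi
      rw [react_rbcOut_eq C i e ht] at hj
      rw [react_abbaIn_eq C i e ht]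
      exact fillZeros_abbaIn_isSome _ (compareSymbols_abbaIn_isSome C _ hi hj)
    · rw [react_abbaOut_eq C i e ht, react_abbaIn_eq C i e ht]
      exact fun h => fillZeros_filled ((s.receive C i e).compareSymbols C) h
    · rw [hfin, finish_terminated_iff C _ hterm, finish_ready]
    · rw [hfin]
      exact finish_output_isSome C _ hterm

end react

end Code

theorem NodeState.Settled.abbaIn_isSome {n t : ℕ} {A : Type*} {s : NodeState n t A}
    (hs : s.Settled) (h : ∀ j, (s.abbaOut j).isSome = true) (j : Fin n) :
    (s.abbaIn j).isSome = true :=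
  hs.filled (by simp [h]) j

/-! ### Executions -/

section Execution

open Filter

variable {n t : ℕ} {A : Type*} {C : ErasureCode n (t + 1) A}
  {rbc : Fin n → Primitive n A A} {abba : Fin n → Primitive n Bool Bool}
  (E : Execution C rbc abba)

theorem Execution.state_succ (k : ℕ) (i : Fin n) :
    E.state (k + 1) i = E.state k i ∨ ∃ e, E.state (k + 1) i = (E.state k i).react C i e := by
  unfold Execution.state
  rw [stateAt]
  rcases E.event k with _ | ⟨i', e⟩
  · exact .inl rfl
  · by_cases h : i = i'
    · exact .inr ⟨e, by simp [h]⟩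
    · exact .inl (by simp [h])

theorem Execution.state_succ_of_event {k : ℕ} {i : Fin n} {e : Event n t A}
    (h : E.event k = some (i, e)) : E.state (k + 1) i = (E.state k i).react C i e := by
  unfold Execution.state
  rw [stateAt, h]
  simp

/-- A property of local states that every reaction preserves holds forever once it holds. -/
theorem Execution.state_of_le {i : Fin n} (p : NodeState n t A → Prop)
    (hp : ∀ s e, p s → p (s.react C i e)) {k k' : ℕ} (hk : k ≤ k') (h : p (E.state k i)) :
    p (E.state k' i) := by
  induction k', hk using Nat.le_induction with
  | base => exact h
  | succ m _ ih =>
    rcases E.state_succ m i with h' | ⟨e, h'⟩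
    · rwa [h']
    · rw [h']; exact hp _ _ ih

theorem Execution.settled (hn : t < n) (k : ℕ) (i : Fin n) : (E.state k i).Settled :=
  E.state_of_le _ (fun _ e h => h.react C i e) (Nat.zero_le k)
    (NodeState.settled_initial hn)

theorem Execution.abbaOut_of_le {i j : Fin n} {b : Bool} {k k' : ℕ} (hk : k ≤ k')
    (h : (E.state k i).abbaOut j = some b) : (E.state k' i).abbaOut j = some b :=
  E.state_of_le (fun s => s.abbaOut j = some b)
    (fun _ e h => NodeState.react_abbaOut C i e h) hk h

theorem Execution.rbcOut_of_le {i j : Fin n} {y : A} {k k' : ℕ} (hk : k ≤ k')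
    (h : (E.state k i).rbcOut j = some y) : (E.state k' i).rbcOut j = some y :=
  E.state_of_le (fun s => s.rbcOut j = some y)
    (fun _ e h => NodeState.react_rbcOut C i e h) hk h

theorem Execution.input_of_le {i : Fin n} {w : Message t A} {k k' : ℕ} (hk : k ≤ k')
    (h : (E.state k i).input = some w) : (E.state k' i).input = some w :=
  E.state_of_le (fun s => s.input = some w)
    (fun _ e h => NodeState.react_input C i e h) hk h

theorem Execution.state_eq_of_terminated {i : Fin n} {k k' : ℕ} (hk : k ≤ k')
    (h : (E.state k i).terminated = true) : E.state k' i = E.state k i :=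
  E.state_of_le (fun s => s = E.state k i)
    (fun s e hs => by subst hs; exact NodeState.react_of_terminated C i e h) hk rfl

/-- An input that reaches a node which has not terminated is recorded. -/
theorem Execution.input_isSome_of_event {i : Fin n} {k : ℕ} {w : Message t A}
    (ht : (E.state k i).terminated = false)
    (h : E.event k = some (i, .input w)) : (E.state (k + 1) i).input.isSome = true := by
  rw [E.state_succ_of_event h, NodeState.react_input_eq C i _ ht]
  cases hi : (E.state k i).input <;> simp [NodeState.receive, hi]

/-- The broadcast run led by node `j` in the execution. -/
noncomputable abbrev Execution.rbcTrace (j : Fin n) : Run n A A := rbcRun E.faulty (stateAt C E.event) j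

/-- The run of the `j`th agreement instance in the execution. -/
noncomputable abbrev Execution.abbaTrace (j : Fin n) : Run n Bool Bool :=
  abbaRun E.faulty (stateAt C E.event) j

variable {E}

theorem Execution.rbcTrace_apply {i : Fin n} (hi : i ∉ E.faulty) (j : Fin n) (k : ℕ) :
    E.rbcTrace j k i = ⟨if i = j then (E.state k i).rbcIn else none, (E.state k i).rbcOut j,
      (E.state k i).terminated⟩ := by
  simp [Execution.rbcTrace, rbcRun, hi, Execution.state]

theorem Execution.abbaTrace_apply {i : Fin n} (hi : i ∉ E.faulty) (j : Fin n) (k : ℕ) :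
    E.abbaTrace j k i = ⟨(E.state k i).abbaIn j, (E.state k i).abbaOut j,
      (E.state k i).terminated⟩ := by
  simp [Execution.abbaTrace, abbaRun, hi, Execution.state]

theorem Execution.rbcTrace_outputs {i : Fin n} (hi : i ∉ E.faulty) {j : Fin n} {y : A} :
    (E.rbcTrace j).Outputs i y ↔ ∃ k, (E.state k i).rbcOut j = some y := by
  simp only [Run.Outputs, rbcTrace_apply hi]

theorem Execution.abbaTrace_outputs {i : Fin n} (hi : i ∉ E.faulty) {j : Fin n} {b : Bool} :
    (E.abbaTrace j).Outputs i b ↔ ∃ k, (E.state k i).abbaOut j = some b := by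
  simp only [Run.Outputs, abbaTrace_apply hi]

theorem Execution.abbaTrace_inputs {i : Fin n} (hi : i ∉ E.faulty) {j : Fin n} {b : Bool} :
    (E.abbaTrace j).Inputs i b ↔ ∃ k, (E.state k i).abbaIn j = some b := by
  simp only [Run.Inputs, abbaTrace_apply hi]

theorem Execution.rbcTrace_leader_inputs {j : Fin n} (hj : j ∉ E.faulty) {y : A} :
    (E.rbcTrace j).Inputs j y ↔ ∃ k, (E.state k j).rbcIn = some y := by
  simp only [Run.Inputs, rbcTrace_apply hj, if_true]

/-- Honest nodes terminate only after all agreement instances have delivered. -/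
theorem Execution.abbaTrace_fullParticipation (hn : t < n) (j : Fin n) :
    (E.abbaTrace j).FullParticipation E.faulty := by
  intro i hi k hk
  rw [abbaTrace_apply hi] at hk ⊢
  exact ((E.settled hn k i).terminated_iff.1 hk).1 j

theorem Execution.abbaOut_unique {i j : Fin n} {b b' : Bool} {k k' : ℕ}
    (h : (E.state k i).abbaOut j = some b) (h' : (E.state k' i).abbaOut j = some b') : b = b' :=
  Option.some_inj.1 ((E.abbaOut_of_le (le_max_left k k') h).symm.trans
    (E.abbaOut_of_le (le_max_right k k') h'))

variable (habba : ∀ j, IsByzantineAgreement t (abba j))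
include habba

/-- The outputs of an agreement instance spread from one honest node to all. -/
theorem Execution.abbaOut_spread (hn : t < n) {i i' j : Fin n} (hi : i ∉ E.faulty)
    (hi' : i' ∉ E.faulty) {k : ℕ} {b : Bool} (h : (E.state k i).abbaOut j = some b) :
    ∃ k', (E.state k' i').abbaOut j = some b := by
  rw [← abbaTrace_outputs hi']
  exact (habba j).consistency E.faulty E.faulty_card_le _ (E.abba_mem j)
    (abbaTrace_fullParticipation hn j) b ⟨i, hi, (abbaTrace_outputs hi).2 ⟨k, h⟩⟩ i' hi'

/-- The output spreads from one node to the other, where a recorded delivery never changes. -/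
theorem Execution.abbaOut_agree (hn : t < n) {i i' j : Fin n} (hi : i ∉ E.faulty)
    (hi' : i' ∉ E.faulty) {k k' : ℕ} (h : ((E.state k i).abbaOut j).isSome = true)
    (h' : ((E.state k' i').abbaOut j).isSome = true) :
    (E.state k i).abbaOut j = (E.state k' i').abbaOut j := by
  obtain ⟨b, hb⟩ := Option.isSome_iff_exists.1 h
  obtain ⟨b', hb'⟩ := Option.isSome_iff_exists.1 h'
  obtain ⟨m, hm⟩ := abbaOut_spread habba hn hi hi' hb
  rw [hb, hb', abbaOut_unique hm hb']

/-- If all honest nodes pass inputs into an agreement instance, then it delivers to all of them. -/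
theorem Execution.abbaOut_of_abbaIn (hn : t < n) {j : Fin n}
    (h : ∀ i ∉ E.faulty, ∃ k, ((E.state k i).abbaIn j).isSome = true) {i : Fin n}
    (hi : i ∉ E.faulty) : ∃ k b, (E.state k i).abbaOut j = some b := by
  obtain ⟨b, hb⟩ := (habba j).termination E.faulty E.faulty_card_le _ (E.abba_mem j)
    (abbaTrace_fullParticipation hn j) (fun i' hi' => by
      obtain ⟨k, hk⟩ := h i' hi'
      obtain ⟨v, hv⟩ := Option.isSome_iff_exists.1 hk
      exact ⟨v, (abbaTrace_inputs hi').2 ⟨k, hv⟩⟩) i hi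
  obtain ⟨k, hk⟩ := (abbaTrace_outputs hi).1 hb
  exact ⟨k, b, hk⟩

/-- An agreement instance which delivers `1`, and into which all honest nodes pass inputs, has the
input `1` from some honest node. -/
theorem Execution.exists_abbaIn_true (hn : t < n) {j : Fin n}
    (h : ∀ i ∉ E.faulty, ∃ k, ((E.state k i).abbaIn j).isSome = true) {i : Fin n}
    (hi : i ∉ E.faulty) {k : ℕ} (hk : (E.state k i).abbaOut j = some true) :
    ∃ i' ∉ E.faulty, ∃ k', (E.state k' i').abbaIn j = some true := by
  -- Otherwise all honest inputs are `0`, and validity forces the output `0`.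
  by_contra! hcon
  have := (habba j).validity E.faulty E.faulty_card_le _ (E.abba_mem j)
    (abbaTrace_fullParticipation hn j) false (fun i' hi' => by
      obtain ⟨m, hm⟩ := h i' hi'
      obtain ⟨v, hv⟩ := Option.isSome_iff_exists.1 hm
      cases v with
      | true => exact absurd hv (hcon i' hi' m)
      | false => exact (abbaTrace_inputs hi').2 ⟨m, hv⟩) i hi
  obtain ⟨m, hm⟩ := (abbaTrace_outputs hi).1 this
  exact Bool.false_ne_true (abbaOut_unique hm hk)

/-! ### Termination: combining broadcast and agreement. -/

variable (hrbc : ∀ j, IsReliableBroadcast t j (rbc j))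
include hrbc

/-- If no honest node ever terminates, then all agreement instances deliver everywhere. -/
theorem Execution.abbaOut_of_forall_not_terminated (hn : t < n)
    (hinput : ∀ i ∉ E.faulty, ∃ k w, E.event k = some (i, Event.input w))
    (hterm : ∀ i ∉ E.faulty, ∀ k, (E.state k i).terminated = false)
    {i : Fin n} (hi : i ∉ E.faulty) (j : Fin n) : ∃ k b, (E.state k i).abbaOut j = some b := by
  have hin : ∀ i ∉ E.faulty, ∃ k w, (E.state k i).input = some w := by
    intro i hi
    obtain ⟨k, w, hk⟩ := hinput i hi
    -- A terminated node would ignore its input, so `hterm` is needed here.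
    exact ⟨k + 1, Option.isSome_iff_exists.1 (E.input_isSome_of_event (hterm i hi k) hk)⟩
  have hhonest : ∀ j ∉ E.faulty, ∀ i ∉ E.faulty, ∃ k b, (E.state k i).abbaOut j = some b := by
    intro j hj i hi
    refine abbaOut_of_abbaIn habba hn (fun i hi => ?_) hi
    obtain ⟨k, w, hk⟩ := hin j hj
    obtain ⟨y, hy⟩ := Option.isSome_iff_exists.1
      ((E.settled hn k j).rbcIn_isSome (by simp [hk]))
    have hout := (hrbc j).validity E.faulty E.faulty_card_le _ (E.rbc_mem j)
      -- Full participation is vacuous, as no honest node stops.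
      (fun i hi k hk => by
        rw [show rbcRun E.faulty (stateAt C E.event) j k i = _ from rbcTrace_apply hi j k] at hk
        simp [hterm i hi k] at hk)
      hj y ((rbcTrace_leader_inputs hj).2 ⟨k, hy⟩) i hi
    obtain ⟨m, hm⟩ := (rbcTrace_outputs hi).1 hout
    obtain ⟨m', w', hm'⟩ := hin i hi
    refine ⟨max m m', (E.settled hn _ i).compared ?_ j ?_⟩
    · simp [E.input_of_le (le_max_right m m') hm']
    · simp [E.rbcOut_of_le (le_max_left m m') hm]
  refine abbaOut_of_abbaIn habba hn (fun i hi => ?_) hi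
  -- Deliveries persist and there are finitely many instances, so one moment serves all honest
  -- indices.
  have hev : ∀ᶠ k in atTop, ∀ j, j ∉ E.faulty → ((E.state k i).abbaOut j).isSome = true := by
    refine eventually_all.2 fun j => ?_
    by_cases hj : j ∈ E.faulty
    · exact .of_forall fun _ h => absurd hj h
    · obtain ⟨k, b, hk⟩ := hhonest j hj i hi
      filter_upwards [eventually_ge_atTop k] with m hm _
      simp [E.abbaOut_of_le hm hk]
  obtain ⟨k, hk⟩ := hev.exists
  refine ⟨k, (E.settled hn k i).filled ?_ j⟩
  calc n - t ≤ n - E.faulty.card := Nat.sub_le_sub_left E.faulty_card_le n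
    _ = E.faultyᶜ.card := by rw [Finset.card_compl, Fintype.card_fin]
    _ ≤ _ := Finset.card_le_card fun j hj => by simpa using hk j (by simpa using hj)

/-- All agreement instances deliver at every honest node. -/
theorem Execution.exists_abbaOut (hn : t < n)
    (hinput : ∀ i ∉ E.faulty, ∃ k w, E.event k = some (i, Event.input w))
    {i : Fin n} (hi : i ∉ E.faulty) (j : Fin n) : ∃ k b, (E.state k i).abbaOut j = some b := by
  by_cases hterm : ∀ i ∉ E.faulty, ∀ k, (E.state k i).terminated = false
  · exact abbaOut_of_forall_not_terminated habba hrbc hn hinput hterm hi j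
  · push Not at hterm
    obtain ⟨i', hi', k, hk⟩ := hterm
    obtain ⟨b, hb⟩ := Option.isSome_iff_exists.1
      (((E.settled hn k i').terminated_iff.1 (by simpa using hk)).1 j)
    obtain ⟨m, hm⟩ := abbaOut_spread habba hn hi' hi hb
    exact ⟨m, b, hm⟩

/-- Every honest node terminates. -/
theorem Execution.exists_terminated (hn : t < n)
    (hinput : ∀ i ∉ E.faulty, ∃ k w, E.event k = some (i, Event.input w))
    {i : Fin n} (hi : i ∉ E.faulty) : ∃ k, (E.state k i).terminated = true := by
  have hall : ∀ i ∉ E.faulty, ∃ k, ∀ j, ((E.state k i).abbaOut j).isSome = true := by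
    intro i hi
    refine Eventually.exists (f := atTop) (eventually_all.2 fun j => ?_)
    obtain ⟨k, b, hk⟩ := exists_abbaOut habba hrbc hn hinput hi j
    filter_upwards [eventually_ge_atTop k] with m hm
    simp [E.abbaOut_of_le hm hk]
  obtain ⟨k, hk⟩ := hall i hi
  have hones : ∀ i' ∉ E.faulty, ∀ k', (∀ j, ((E.state k' i').abbaOut j).isSome = true) →
      (E.state k' i').ones = (E.state k i).ones := by
    intro i' hi' k' hk'
    ext j
    simp [NodeState.ones, abbaOut_agree habba hn hi' hi (hk' j) (hk j)]
  by_cases hcard : t + 1 ≤ (E.state k i).ones.card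
  · have hrbcOut : ∀ j ∈ firstSmallest (t + 1) (E.state k i).ones,
        ∃ m y, (E.state m i).rbcOut j = some y := by
      intro j hj
      have hj1 : (E.state k i).abbaOut j = some true := by
        simpa [NodeState.ones] using (Finset.mem_filter.1 hj).1
      -- A stopped node had all agreement outputs, hence the same set of ones, and so had waited for
      -- this very broadcast.
      have hfull : (E.rbcTrace j).FullParticipation E.faulty := by
        intro i' hi' k' hk'
        rw [rbcTrace_apply hi'] at hk' ⊢
        have hready := (E.settled hn k' i').terminated_iff.1 hk'
        have heq := hones i' hi' k' hready.1
        exact hready.2 (by rwa [heq]) j (by rwa [heq])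
      -- Every honest node has fed instance `j` by the time all instances have delivered to it,
      -- thanks to the filling rule.
      obtain ⟨i', hi', k', hk'⟩ := exists_abbaIn_true habba hn
        (fun i' hi' => (hall i' hi').imp fun m hm => (E.settled hn m i').abbaIn_isSome hm j)
        hi hj1
      obtain ⟨y, hy⟩ := Option.isSome_iff_exists.1 ((E.settled hn k' i').rbcOut_isSome j hk')
      obtain ⟨y', hy'⟩ := (hrbc j).totality E.faulty E.faulty_card_le _ (E.rbc_mem j) hfull
        ⟨i', hi', y, (rbcTrace_outputs hi').2 ⟨k', hy⟩⟩ i hi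
      obtain ⟨m, hm⟩ := (rbcTrace_outputs hi).1 hy'
      exact ⟨m, y', hm⟩
    have hev : ∀ᶠ m in atTop, ∀ j, j ∈ firstSmallest (t + 1) (E.state k i).ones →
        ((E.state m i).rbcOut j).isSome = true := by
      refine eventually_all.2 fun j => ?_
      by_cases hj : j ∈ firstSmallest (t + 1) (E.state k i).ones
      · obtain ⟨m, y, hm⟩ := hrbcOut j hj
        filter_upwards [eventually_ge_atTop m] with m' hm' _
        simp [E.rbcOut_of_le hm' hm]
      · exact .of_forall fun _ h => absurd h hj
    obtain ⟨m, hm, hkm⟩ := (hev.and (eventually_ge_atTop k)).exists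
    have hout : ∀ j, ((E.state m i).abbaOut j).isSome = true := fun j => by
      obtain ⟨b, hb⟩ := Option.isSome_iff_exists.1 (hk j)
      simp [E.abbaOut_of_le hkm hb]
    refine ⟨m, (E.settled hn m i).terminated_iff.2 ⟨hout, fun _ => ?_⟩⟩
    rwa [hones i hi m hout]
  · exact ⟨k, (E.settled hn k i).terminated_iff.2 ⟨hk, fun h => absurd h hcard⟩⟩

end Execution

end AsyncBA

theorem mainTheorem10 {n t : ℕ} (hn : n ≥ 3 * t + 1) {A : Type*}
    (C : AsyncBA.ErasureCode n (t + 1) A)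
    (rbc : Fin n → AsyncBA.Primitive n A A)
    (hrbc : ∀ j, AsyncBA.IsReliableBroadcast t j (rbc j))
    (abba : Fin n → AsyncBA.Primitive n Bool Bool)
    (habba : ∀ j, AsyncBA.IsByzantineAgreement t (abba j))
    (E : AsyncBA.Execution C rbc abba)
    (hinput : ∀ i ∉ E.faulty, ∃ k w, E.event k = some (i, AsyncBA.Event.input w)) :
    (∀ i ∉ E.faulty, ∀ j, ∃ b, ∃ k₀, ∀ k ≥ k₀, (E.state k i).abbaOut j = some b) ∧
    (∀ i ∉ E.faulty, ∃ v, ∃ k₀, ∀ k ≥ k₀,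
      (E.state k i).output = some v ∧ (E.state k i).terminated = true) := by
  have htn : t < n := by omega
  constructor
  · intro i hi j
    obtain ⟨k, b, hk⟩ := AsyncBA.Execution.exists_abbaOut habba hrbc htn hinput hi j
    exact ⟨b, k, fun m hm => E.abbaOut_of_le hm hk⟩
  · intro i hi
    obtain ⟨k, hk⟩ := AsyncBA.Execution.exists_terminated habba hrbc htn hinput hi
    obtain ⟨v, hv⟩ := Option.isSome_iff_exists.1 ((E.settled htn k i).output_isSome hk)
    refine ⟨v, k, fun m hm => ?_⟩
    rw [E.state_eq_of_terminated hm hk]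
    exact ⟨hv, hk⟩
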